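/- Let $G$ be a non-discrete (equivalently, infinite) compact Hausdorff abelian group with normalized Haar measure $m(G)=1$, and let $\widehat G$ be its (discrete) dual group with counting measure. For $2<p<\infty$ let \[ A_p(G)=\{f\in L^1(G):\ \widehat f\in\ell^p(\widehat G)\},\qquad \|f\|_{A_p(G)}=\|f\|_{L^1(G)}+\|\widehat f\|_{\ell^p(\widehat G)},\qquad \widehat f(\gamma)=\int_G f(t)\overline{\gamma(t)}\,dt, \] with convolution as multiplication, and let $A_p(G)^1=\mathbb C\mathbf 1\oplus A_p(G)$ be its unitization with the norm $\|\lambda\mathbf 1+f\|=|\lambda|+\|f\|_{A_p(G)}$. For $x=\lambda\mathbf 1+f\in A_p(G)^1$ put $\widehat x(\gamma)=\lambda+\widehat f(\gamma)$, $\gamma\in\widehat G$. Let $n$ be the smallest positive odd integer with $p/n\le 2$, and for $\delta>0$ put \[ \Delta_n=\delta^{2n}\bigl(1-(1-\delta^2)^n\bigr). \] Then for every $\delta>0$ and every $x=\lambda\mathbf 1+f\in A_p(G)^1$ with $\|x\|\le 1$ and $|\widehat x(\gamma)|\ge\delta$ for all $\gamma\in\widehat G$, the element $x$ is invertible in $A_p(G)^1$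 and \[ \|x^{-1}\|\le \frac{1}{\delta^{2n}}+\frac{2(1-\Delta_n)}{\Delta_n^2}. \] In particular norm-controlled inversion holds for every $\delta>0$: \[ \sup\bigl\{\|x^{-1}\|:\ x\in A_p(G)^1\text{ invertible},\ \|x\|\le 1,\ |\widehat x(\gamma)|\ge\delta\text{ for all }\gamma\in\widehat G\bigr\}<\infty . \] -/

import Mathlib

open MeasureTheory
open scoped ENNReal ComplexConjugate

namespace FourierAlgebra

noncomputable section

section Characters

variable {G : Type*} [CommGroup G] [TopologicalSpace G]

/-- The value `γ(t)` of a character, as a complex number. -/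
def chi (γ : PontryaginDual G) (t : G) : ℂ := Circle.coeHom (γ t)

theorem norm_chi (γ : PontryaginDual G) (t : G) : ‖chi γ t‖ = 1 := Circle.norm_coe _

theorem chi_mul (γ : PontryaginDual G) (s t : G) : chi γ (s * t) = chi γ s * chi γ t := by
  simp only [chi, map_mul]

theorem continuous_chi (γ : PontryaginDual G) : Continuous (chi γ) :=
  continuous_subtype_val.comp (map_continuous γ)

end Characters

section Defs

variable (G : Type*) [CommGroup G] [TopologicalSpace G] [IsTopologicalGroup G] [CompactSpace G]
  [MeasurableSpace G] [BorelSpace G]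

/-- The Haar measure of the compact group `G`, normalized by `m(G) = 1`. -/
abbrev haar : Measure G := Measure.haarMeasure (⊤ : TopologicalSpace.PositiveCompacts G)

instance haar_isProbabilityMeasure : IsProbabilityMeasure (haar G) :=
  ⟨Measure.haarMeasure_self⟩

instance one_ne_top_fact : Fact ((1 : ℝ≥0∞) ≠ ∞) := ⟨ENNReal.one_ne_top⟩

/-- The Banach space `L¹(G)`. -/
abbrev L1 : Type _ := Lp ℂ 1 (haar G)

variable {G}

/-- The convolution `(f * g)(t) = ∫ f(s) g(s⁻¹ t) ds` of two functions on `G`. -/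
def conv (f g : G → ℂ) (t : G) : ℂ := ∫ s, f s * g (s⁻¹ * t) ∂(haar G)

/-- The Fourier transform `f̂(γ) = ∫ f(t) conj(γ(t)) dt` of `f ∈ L¹(G)`, as a function on the dual
group of `G`. -/
def fourier (f : L1 G) (γ : PontryaginDual G) : ℂ :=
  ∫ t, f t * conj (chi γ t) ∂(haar G)

/-! ### Convolution on `L¹(G)` is well defined -/

/-- The translate `t ↦ g (s⁻¹ t)` of an element of `L¹(G)`. -/
def shift (s : G) (g : L1 G) : L1 G := DomMulAct.mk s⁻¹ • g

theorem shift_coe (s : G) (g : L1 G) : shift s g =ᵐ[haar G] fun t => g (s⁻¹ * t) :=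
  DomMulAct.smul_Lp_ae_eq _ _

theorem norm_shift (s : G) (g : L1 G) : ‖shift s g‖ = ‖g‖ := DomMulAct.norm_smul_Lp _ _

theorem shift_shift (s r : G) (g : L1 G) : shift s (shift r g) = shift (s * r) g := by
  unfold shift
  rw [← mul_smul, ← DomMulAct.mk_mul, mul_inv]
  congr 2
  exact mul_comm _ _

theorem continuous_shift (g : L1 G) : Continuous fun s : G => shift s g := by
  unfold shift
  exact (DomMulAct.continuous_mk.comp continuous_inv).smul continuous_const

theorem stronglyMeasurable_shift (g : L1 G) : StronglyMeasurable fun s : G => shift s g :=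
  (continuous_shift g).stronglyMeasurable_of_hasCompactSupport
    (HasCompactSupport.of_compactSpace _)

theorem integrable_shift (f g : L1 G) :
    Integrable (fun s => f s • shift s g) (haar G) := by
  refine (L1.integrable_coeFn f).smul_of_top_left ?_
  refine memLp_top_of_bound (stronglyMeasurable_shift g).aestronglyMeasurable ‖g‖ ?_
  exact Filter.Eventually.of_forall fun s => (norm_shift s g).le

/-- Every element of `L¹(G)` has a representative for which the integrand of the convolution is
measurable for the product σ-algebra (`G` need not be second countable). -/
theorem exists_good (g : L1 G) : ∃ H : G → ℂ, g =ᵐ[haar G] H ∧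
    StronglyMeasurable fun z : G × G => H (z.1⁻¹ * z.2) := by
  have hd := ContinuousMap.toLp_denseRange ℂ (haar G) ℂ (ENNReal.one_ne_top)
  obtain ⟨v, hv, hvt⟩ := mem_closure_iff_seq_limit.1 (hd g)
  choose u hu using hv
  have hm : TendstoInMeasure (haar G) (fun n => (v n : G → ℂ)) Filter.atTop g :=
    tendstoInMeasure_of_tendsto_Lp hvt
  obtain ⟨ns, -, hns⟩ := hm.exists_seq_tendsto_ae
  refine ⟨fun x => Filter.limUnder Filter.atTop fun k => u (ns k) x, ?_, ?_⟩
  · have hall : ∀ᵐ x ∂(haar G), ∀ n, v n x = u n x := by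
      refine ae_all_iff.2 fun n => ?_
      rw [← hu n]
      exact ContinuousMap.coeFn_toLp (haar G) (u n)
    filter_upwards [hns, hall] with x hx hx'
    simp only [hx'] at hx
    exact hx.limUnder_eq.symm
  · refine StronglyMeasurable.limUnder (l := Filter.atTop) fun k => ?_
    exact (HasCompactSupport.of_compactSpace _).stronglyMeasurable_of_prod
      (f := fun z : G × G => u (ns k) (z.1⁻¹ * z.2)) (by fun_prop)

theorem conv_congr {f f' g g' : G → ℂ} (hf : f =ᵐ[haar G] f') (hg : g =ᵐ[haar G] g') :
    conv f g = conv f' g' := by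
  funext t
  refine integral_congr_ae ?_
  have hq : Measure.QuasiMeasurePreserving (fun s : G => s⁻¹ * t) (haar G) (haar G) :=
    ((measurePreserving_mul_right (haar G) t).comp
      (Measure.measurePreserving_inv (haar G))).quasiMeasurePreserving
  filter_upwards [hf, hq.ae hg] with s h1 h2
  rw [h1, h2]

theorem conv_comm (f g : G → ℂ) : conv f g = conv g f := by
  funext t
  unfold conv
  rw [← integral_inv_eq_self, ← integral_mul_left_eq_self _ t⁻¹]
  refine integral_congr_ae (Filter.Eventually.of_forall fun s => ?_)
  simp only [mul_inv, inv_inv]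
  rw [show t * s⁻¹ = s⁻¹ * t from mul_comm _ _, mul_comm (f _)]
  congr 2
  simp [mul_comm]

theorem integrable_kernel_aux {F H : G → ℂ} (hF : Integrable F (haar G))
    (hHi : Integrable H (haar G))
    (hH : StronglyMeasurable fun z : G × G => H (z.1⁻¹ * z.2)) :
    Integrable (fun z : G × G => F z.1 * H (z.1⁻¹ * z.2)) ((haar G).prod (haar G)) := by
  have h1 : AEStronglyMeasurable (fun z : G × G => F z.1) ((haar G).prod (haar G)) :=
    hF.1.comp_fst
  have hm : AEStronglyMeasurable (fun z : G × G => F z.1 * H (z.1⁻¹ * z.2))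
      ((haar G).prod (haar G)) := h1.mul hH.aestronglyMeasurable
  refine (integrable_prod_iff hm).2 ⟨Filter.Eventually.of_forall fun s => ?_, ?_⟩
  · exact (hHi.comp_mul_left s⁻¹).const_mul (F s)
  · have h2 : ∀ s : G, ∫ t, ‖F s * H (s⁻¹ * t)‖ ∂(haar G)
        = ‖F s‖ * ∫ t, ‖H t‖ ∂(haar G) := fun s => by
      simp only [norm_mul]
      rw [integral_const_mul, integral_mul_left_eq_self (fun t => ‖H t‖) s⁻¹]
    simp only [h2]
    exact hF.norm.mul_const _

theorem integrable_kernel {f g : L1 G} {H : G → ℂ} (hg : g =ᵐ[haar G] H)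
    (hH : StronglyMeasurable fun z : G × G => H (z.1⁻¹ * z.2)) :
    Integrable (fun z : G × G => f z.1 * H (z.1⁻¹ * z.2)) ((haar G).prod (haar G)) :=
  integrable_kernel_aux (L1.integrable_coeFn f) ((L1.integrable_coeFn g).congr hg) hH

theorem integrable_conv (f g : L1 G) : Integrable (conv f g) (haar G) := by
  obtain ⟨H, hg, hH⟩ := exists_good g
  rw [conv_congr (Filter.EventuallyEq.refl _ _) hg]
  exact (integrable_kernel hg hH).integral_prod_right

/-- Convolution as a multiplication on `L¹(G)`. -/
def mulL1 (f g : L1 G) : L1 G := (integrable_conv f g).toL1 (conv f g)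

theorem mulL1_coe (f g : L1 G) : mulL1 f g =ᵐ[haar G] conv f g := Integrable.coeFn_toL1 _

/-! ### Pairing with bounded functions, and the algebra laws -/

theorem integrable_pair {φ : G → ℂ} (hφ : Measurable φ) {C : ℝ} (hC : ∀ t, ‖φ t‖ ≤ C) (g : L1 G) :
    Integrable (fun t => g t * φ t) (haar G) :=
  (L1.integrable_coeFn g).mul_bdd (c := C) hφ.aestronglyMeasurable (Filter.Eventually.of_forall hC)

/-- The functional `g ↦ ∫ g φ` on `L¹(G)` for a bounded measurable `φ`. -/
def pair (φ : G → ℂ) (hφ : Measurable φ) (C : ℝ) (hC : ∀ t, ‖φ t‖ ≤ C) : L1 G →L[ℂ] ℂ :=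
  LinearMap.mkContinuous
    { toFun := fun g => ∫ t, g t * φ t ∂(haar G)
      map_add' := fun g h => by
        rw [← integral_add (integrable_pair hφ hC g) (integrable_pair hφ hC h)]
        refine integral_congr_ae ?_
        filter_upwards [Lp.coeFn_add g h] with t ht
        rw [ht, Pi.add_apply, add_mul]
      map_smul' := fun c g => by
        simp only [RingHom.id_apply, smul_eq_mul]
        rw [← integral_const_mul]
        refine integral_congr_ae ?_
        filter_upwards [Lp.coeFn_smul c g] with t ht
        rw [ht, Pi.smul_apply, smul_eq_mul, mul_assoc] } C
    (fun g => by
      rw [L1.norm_eq_integral_norm, ← integral_const_mul]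
      refine norm_integral_le_of_norm_le ((L1.integrable_coeFn g).norm.const_mul C)
        (Filter.Eventually.of_forall fun t => ?_)
      rw [norm_mul, mul_comm]
      exact mul_le_mul_of_nonneg_right (hC t) (norm_nonneg _))

theorem pair_apply (φ : G → ℂ) (hφ : Measurable φ) (C : ℝ) (hC : ∀ t, ‖φ t‖ ≤ C) (g : L1 G) :
    pair φ hφ C hC g = ∫ t, g t * φ t ∂(haar G) := rfl

theorem pair_mulL1 (φ : G → ℂ) (hφ : Measurable φ) (C : ℝ) (hC : ∀ t, ‖φ t‖ ≤ C) (f g : L1 G) :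
    pair φ hφ C hC (mulL1 f g) = ∫ s, f s * pair φ hφ C hC (shift s g) ∂(haar G) := by
  obtain ⟨H, hg, hH⟩ := exists_good g
  have h1 : pair φ hφ C hC (mulL1 f g)
      = ∫ t, ∫ s, (f s * H (s⁻¹ * t)) * φ t ∂(haar G) ∂(haar G) := by
    rw [pair_apply]
    refine integral_congr_ae ?_
    filter_upwards [mulL1_coe f g] with t ht
    rw [ht, conv_congr (Filter.EventuallyEq.refl _ _) hg, conv, integral_mul_const]
  have hI : Integrable (fun z : G × G => f z.1 * H (z.1⁻¹ * z.2) * φ z.2)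
      ((haar G).prod (haar G)) :=
    (integrable_kernel hg hH).mul_bdd (c := C) (hφ.comp measurable_snd).aestronglyMeasurable
      (Filter.Eventually.of_forall fun z => hC z.2)
  rw [h1, ← integral_integral_swap hI]
  refine integral_congr_ae (Filter.Eventually.of_forall fun s => ?_)
  simp only [mul_assoc, integral_const_mul, pair_apply]
  congr 1
  refine integral_congr_ae ?_
  have hq := (measurePreserving_mul_left (haar G) s⁻¹).quasiMeasurePreserving.ae hg
  filter_upwards [shift_coe s g, hq] with t h1 h2
  rw [h1, h2]

/-- Convolution is also the vector-valued integral `∫ f(s) g(s⁻¹ ·) ds`. -/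
theorem mulL1_eq (f g : L1 G) : mulL1 f g = ∫ s, f s • shift s g ∂(haar G) := by
  refine Lp.ext (Integrable.ae_eq_of_forall_setIntegral_eq _ _ (L1.integrable_coeFn _)
    (L1.integrable_coeFn _) fun A hA _ => ?_)
  have hm : Measurable (A.indicator (1 : G → ℂ)) := measurable_one.indicator hA
  have hb : ∀ t, ‖A.indicator (1 : G → ℂ) t‖ ≤ 1 := fun t => by
    by_cases h : t ∈ A <;> simp [h]
  have key : ∀ h : L1 G, ∫ t in A, h t ∂(haar G) = pair _ hm 1 hb h := fun h => by
    rw [pair_apply, ← integral_indicator hA]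
    refine integral_congr_ae (Filter.Eventually.of_forall fun t => ?_)
    by_cases h : t ∈ A <;> simp [h]
  rw [key, key, pair_mulL1, ← ContinuousLinearMap.integral_comp_comm _ (integrable_shift f g)]
  simp

theorem mulL1_comm (f g : L1 G) : mulL1 f g = mulL1 g f := by
  refine Lp.ext ?_
  filter_upwards [mulL1_coe f g, mulL1_coe g f] with t h1 h2
  rw [h1, h2, conv_comm]

theorem shift_add (s : G) (g h : L1 G) : shift s (g + h) = shift s g + shift s h :=
  DomMulAct.smul_Lp_add _ _ _

theorem shift_smul (s : G) (c : ℂ) (g : L1 G) : shift s (c • g) = c • shift s g :=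
  smul_comm _ _ _

theorem mulL1_add (f g h : L1 G) : mulL1 f (g + h) = mulL1 f g + mulL1 f h := by
  simp only [mulL1_eq, shift_add, smul_add]
  exact integral_add (integrable_shift f g) (integrable_shift f h)

theorem mulL1_smul (c : ℂ) (f g : L1 G) : mulL1 f (c • g) = c • mulL1 f g := by
  simp only [mulL1_eq, shift_smul]
  rw [← integral_smul]
  simp only [smul_comm c]

theorem norm_mulL1_le (f g : L1 G) : ‖mulL1 f g‖ ≤ ‖f‖ * ‖g‖ := by
  rw [mulL1_eq, L1.norm_eq_integral_norm f, ← integral_mul_const]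
  refine norm_integral_le_of_norm_le ((L1.integrable_coeFn f).norm.mul_const _)
    (Filter.Eventually.of_forall fun s => ?_)
  rw [norm_smul, norm_shift]

/-- Convolution by `g` on the left factor, as a continuous linear map. -/
def mulRight (g : L1 G) : L1 G →L[ℂ] L1 G :=
  LinearMap.mkContinuous
    { toFun := fun f => mulL1 f g
      map_add' := fun f f' => by simp only [mulL1_comm _ g, mulL1_add]
      map_smul' := fun c f => by simp only [mulL1_comm _ g, mulL1_smul, RingHom.id_apply] } ‖g‖
    (fun f => by
      rw [mul_comm]
      exact norm_mulL1_le f g)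

/-- Translation as a continuous linear map. -/
def shiftL (s : G) : L1 G →L[ℂ] L1 G :=
  LinearMap.mkContinuous
    { toFun := shift s
      map_add' := shift_add s
      map_smul' := fun c f => shift_smul s c f } 1
    (fun f => by rw [one_mul]; exact (norm_shift s f).le)

theorem shift_mulL1 (s : G) (f g : L1 G) : mulL1 f (shift s g) = shift s (mulL1 f g) := by
  have h : shift s (mulL1 f g) = shiftL s (mulL1 f g) := rfl
  rw [h, mulL1_eq f g, ← ContinuousLinearMap.integral_comp_comm _ (integrable_shift f g), mulL1_eq]
  refine integral_congr_ae (Filter.Eventually.of_forall fun r => ?_)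
  simp only [map_smul]
  change _ = f r • shift s (shift r g)
  rw [shift_shift, shift_shift, mul_comm]

theorem mulL1_assoc (f g h : L1 G) : mulL1 (mulL1 f g) h = mulL1 f (mulL1 g h) := by
  change mulRight h (mulL1 f g) = _
  rw [mulL1_eq f g, ← ContinuousLinearMap.integral_comp_comm _ (integrable_shift f g),
    mulL1_eq f (mulL1 g h)]
  refine integral_congr_ae (Filter.Eventually.of_forall fun s => ?_)
  simp only [map_smul]
  change f s • mulL1 (shift s g) h = _
  rw [mulL1_comm _ h, shift_mulL1, mulL1_comm h g]

/-! ### The Fourier transform is multiplicative -/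

theorem fourier_eq_pair (γ : PontryaginDual G) : ∃ L : L1 G →L[ℂ] ℂ, (∀ f, L f = fourier f γ) ∧
    ∀ f g, L (mulL1 f g) = ∫ s, f s * L (shift s g) ∂(haar G) := by
  have hc : Continuous fun t : G => conj (chi γ t) :=
    Complex.continuous_conj.comp (continuous_chi γ)
  have hb : ∀ t : G, ‖conj (chi γ t)‖ ≤ 1 := fun t => by simp [norm_chi]
  exact ⟨pair _ hc.measurable 1 hb, fun f => rfl, pair_mulL1 _ _ _ _⟩

theorem fourier_add (f g : L1 G) : fourier (f + g) = fourier f + fourier g := by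
  funext γ
  obtain ⟨L, hL, -⟩ := fourier_eq_pair γ
  simp only [Pi.add_apply, ← hL, map_add]

theorem fourier_smul (c : ℂ) (f : L1 G) : fourier (c • f) = c • fourier f := by
  funext γ
  obtain ⟨L, hL, -⟩ := fourier_eq_pair γ
  simp only [Pi.smul_apply, ← hL, map_smul]

theorem fourier_zero : fourier (0 : L1 G) = 0 := by
  simpa using fourier_smul 0 (0 : L1 G)

theorem norm_fourier_le (f : L1 G) (γ : PontryaginDual G) : ‖fourier f γ‖ ≤ ‖f‖ := by
  rw [L1.norm_eq_integral_norm]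
  refine norm_integral_le_of_norm_le (L1.integrable_coeFn f).norm
    (Filter.Eventually.of_forall fun t => ?_)
  simp [norm_chi]

theorem fourier_shift (s : G) (g : L1 G) (γ : PontryaginDual G) :
    fourier (shift s g) γ = conj (chi γ s) * fourier g γ := by
  unfold fourier
  rw [← integral_const_mul, ← integral_mul_left_eq_self _ s]
  refine integral_congr_ae ?_
  have hq := (measurePreserving_mul_left (haar G) s).quasiMeasurePreserving.ae (shift_coe s g)
  filter_upwards [hq] with t ht
  rw [ht]
  simp only [inv_mul_cancel_left, map_mul, chi_mul]
  ring

theorem fourier_mulL1 (f g : L1 G) : fourier (mulL1 f g) = fourier f * fourier g := by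
  funext γ
  obtain ⟨L, hL, hM⟩ := fourier_eq_pair γ
  rw [← hL, hM]
  simp only [hL, fourier_shift, Pi.mul_apply, ← mul_assoc]
  rw [integral_mul_const, ← fourier]

end Defs

/-! ### The algebra `A_p(G)` -/

section Algebra

variable (G : Type*) [CommGroup G] [TopologicalSpace G] [IsTopologicalGroup G] [CompactSpace G]
  [MeasurableSpace G] [BorelSpace G] (p : ℝ)

/-- The subspace `{f ∈ L¹(G) : f̂ ∈ ℓᵖ(Ĝ)}` of `L¹(G)`. The dual group of the compact group `G` is
discrete and carries the counting measure. -/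
def apSubmodule : Submodule ℂ (L1 G) where
  carrier := {f | Memℓp (fourier f) (ENNReal.ofReal p)}
  add_mem' := fun {f g} hf hg => by
    simp only [Set.mem_ofPred_eq, fourier_add] at *
    exact hf.add hg
  zero_mem' := by
    simp only [Set.mem_ofPred_eq, fourier_zero]
    exact zero_memℓp
  smul_mem' := fun c f hf => by
    simp only [Set.mem_ofPred_eq, fourier_smul] at *
    exact hf.const_smul c

/-- The space `A_p(G) = {f ∈ L¹(G) : f̂ ∈ ℓᵖ(Ĝ)}`. -/
def Ap : Type _ := ↥(apSubmodule G p)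

variable {G p}

namespace Ap

instance : AddCommGroup (Ap G p) := inferInstanceAs (AddCommGroup ↥(apSubmodule G p))

instance : Module ℂ (Ap G p) := inferInstanceAs (Module ℂ ↥(apSubmodule G p))

/-- The inclusion of `A_p(G)` in `L¹(G)`. -/
def toL1 : Ap G p →ₗ[ℂ] L1 G := (apSubmodule G p).subtype

theorem toL1_injective : Function.Injective (toL1 : Ap G p →ₗ[ℂ] L1 G) := Subtype.val_injective

/-- The Fourier transform from `A_p(G)` to `ℓᵖ(Ĝ)`. -/
def toLp : Ap G p →ₗ[ℂ] lp (fun _ : PontryaginDual G => ℂ) (ENNReal.ofReal p) where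
  toFun f := ⟨fourier (toL1 f), f.2⟩
  map_add' f g := Subtype.ext (fourier_add (toL1 f) (toL1 g))
  map_smul' c f := Subtype.ext (fourier_smul c (toL1 f))

theorem toLp_coe (f : Ap G p) : (toLp f : PontryaginDual G → ℂ) = fourier (toL1 f) := rfl

theorem mul_mem {f g : L1 G} (hg : Memℓp (fourier g) (ENNReal.ofReal p)) :
    Memℓp (fourier (mulL1 f g)) (ENNReal.ofReal p) := by
  refine (hg.const_smul (‖f‖ : ℂ)).mono' fun γ => ?_
  rw [fourier_mulL1, Pi.mul_apply, Pi.smul_apply, norm_mul, norm_smul, Complex.norm_real, norm_norm]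
  exact mul_le_mul_of_nonneg_right (norm_fourier_le f γ) (norm_nonneg _)

/-- The product of `A_p(G)` is convolution. -/
instance : Mul (Ap G p) := ⟨fun f g => ⟨mulL1 (toL1 f) (toL1 g), mul_mem g.2⟩⟩

theorem toL1_mul (f g : Ap G p) : toL1 (f * g) = mulL1 (toL1 f) (toL1 g) := rfl

variable [hp : Fact (1 ≤ p)]

instance ofReal_fact : Fact (1 ≤ ENNReal.ofReal p) := ⟨by simpa using hp.out⟩

/-- The norm of `A_p(G)` is `‖f‖ = ‖f‖₁ + ‖f̂‖_p`. -/
instance : NormedAddCommGroup (Ap G p) :=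
  AddGroupNorm.toNormedAddCommGroup
    { toFun := fun f => ‖toL1 f‖ + ‖toLp f‖
      map_zero' := by simp
      add_le' := fun f g => by
        rw [map_add, map_add]
        linarith [norm_add_le (toL1 f) (toL1 g), norm_add_le (toLp f) (toLp g)]
      neg' := fun f => by rw [map_neg, map_neg, norm_neg, norm_neg]
      eq_zero_of_map_eq_zero' := fun f hf => by
        have h : ‖toL1 f‖ = 0 := by
          linarith [norm_nonneg (toL1 f), norm_nonneg (toLp f)]
        exact toL1_injective (by rw [norm_eq_zero.1 h, map_zero]) }

theorem norm_def (f : Ap G p) : ‖f‖ = ‖toL1 f‖ + ‖toLp f‖ := rfl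

theorem norm_toLp (f : Ap G p) :
    ‖toLp f‖ = (∑' γ : PontryaginDual G, ‖fourier (toL1 f) γ‖ ^ p) ^ (1 / p) := by
  have h0 : 0 ≤ p := zero_le_one.trans hp.out
  have h : (ENNReal.ofReal p).toReal = p := ENNReal.toReal_ofReal h0
  rw [lp.norm_eq_tsum_rpow (by rw [h]; linarith [hp.out]), h, toLp_coe]

theorem norm_mul_le' (f g : Ap G p) : ‖f * g‖ ≤ ‖f‖ * ‖g‖ := by
  have h1 : ‖toLp (f * g)‖ ≤ ‖toL1 f‖ * ‖toLp g‖ := by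
    have h0 : ENNReal.ofReal p ≠ 0 := by
      have := hp.out
      simp only [ne_eq, ENNReal.ofReal_eq_zero, not_le]
      linarith
    have h2 : ‖toLp (f * g)‖ ≤ ‖(‖toL1 f‖ : ℂ) • toLp g‖ := by
      refine lp.norm_mono h0 fun γ => ?_
      rw [lp.coeFn_smul, toLp_coe, toLp_coe, toL1_mul, fourier_mulL1, Pi.mul_apply, Pi.smul_apply,
        norm_mul, norm_smul, Complex.norm_real, norm_norm]
      exact mul_le_mul_of_nonneg_right (norm_fourier_le _ γ) (norm_nonneg _)
    rwa [norm_smul, Complex.norm_real, norm_norm] at h2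
  have h3 := norm_mulL1_le (toL1 f) (toL1 g)
  rw [norm_def, norm_def f, norm_def g, toL1_mul]
  nlinarith [mul_nonneg (norm_nonneg (toLp f)) (norm_nonneg (toL1 g)),
    mul_nonneg (norm_nonneg (toLp f)) (norm_nonneg (toLp g))]

instance : NonUnitalNormedCommRing (Ap G p) where
  left_distrib f g h := toL1_injective (mulL1_add _ _ _)
  right_distrib f g h := toL1_injective (by
    simp only [map_add, toL1_mul, mulL1_comm _ (toL1 h), mulL1_add])
  zero_mul f := toL1_injective (by
    rw [toL1_mul, mulL1_comm, map_zero]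
    simpa using mulL1_smul 0 (toL1 f) 0)
  mul_zero f := toL1_injective (by
    rw [toL1_mul, map_zero]
    simpa using mulL1_smul 0 (toL1 f) 0)
  mul_assoc f g h := toL1_injective (mulL1_assoc _ _ _)
  mul_comm f g := toL1_injective (mulL1_comm _ _)
  dist_eq := dist_eq_norm_neg_add
  norm_mul_le := norm_mul_le'

instance : NormedSpace ℂ (Ap G p) where
  norm_smul_le c f := by
    rw [norm_def, norm_def, map_smul, map_smul, norm_smul, norm_smul, mul_add]

instance : SMulCommClass ℂ (Ap G p) (Ap G p) where
  smul_comm c f g := toL1_injective (mulL1_smul c (toL1 f) (toL1 g)).symm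

instance : IsScalarTower ℂ (Ap G p) (Ap G p) where
  smul_assoc c f g := toL1_injective (by
    simp only [smul_eq_mul, toL1_mul, map_smul, mulL1_comm _ (toL1 g), mulL1_smul])

end Ap

variable (G p) in
/-- The unitization `A_p(G)¹ = ℂ𝟏 ⊕ A_p(G)` with the norm `‖λ𝟏 + f‖ = |λ| + ‖f‖`. -/
abbrev ApUnit [Fact (1 ≤ p)] : Type _ := WithLp 1 (Unitization ℂ (Ap G p))

variable [Fact (1 ≤ p)]

/-- The element `λ𝟏 + f` of the unitization. -/
def ApUnit.mk (l : ℂ) (f : Ap G p) : ApUnit G p :=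
  WithLp.toLp 1 (Unitization.inl l + (f : Unitization ℂ (Ap G p)))

theorem ApUnit.norm_mk (l : ℂ) (f : Ap G p) : ‖ApUnit.mk l f‖ = ‖l‖ + ‖f‖ := by
  simp [WithLp.unitization_norm_def, ApUnit.mk]

/-- The Gelfand transform on the visible part `Ĝ` of the spectrum: `x̂(γ) = λ + f̂(γ)` for
`x = λ𝟏 + f`. -/
def ApUnit.hat (x : ApUnit G p) (γ : PontryaginDual G) : ℂ :=
  (WithLp.ofLp x).fst + fourier (Ap.toL1 (WithLp.ofLp x).snd) γ

theorem ApUnit.hat_mk (l : ℂ) (f : Ap G p) (γ : PontryaginDual G) :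
    ApUnit.hat (ApUnit.mk l f) γ = l + fourier (Ap.toL1 f) γ := by
  simp [ApUnit.hat, ApUnit.mk]

variable (G p) in
/-- The norm-controlled inversion constant: the supremum of `‖x⁻¹‖` over all invertible `x` in
`A_p(G)¹` with `‖x‖ ≤ 1` and `inf |x̂| ≥ δ` on `Ĝ`. -/
def inversionConstant (δ : ℝ) : ℝ≥0∞ :=
  ⨆ (u : (ApUnit G p)ˣ) (_ : ‖(u : ApUnit G p)‖ ≤ 1)
    (_ : ∀ γ, δ ≤ ‖ApUnit.hat (u : ApUnit G p) γ‖),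
    ENNReal.ofReal ‖((u⁻¹ : (ApUnit G p)ˣ) : ApUnit G p)‖

end Algebra

end

end FourierAlgebra

namespace FourierAlgebra

noncomputable section

/-! Why it holds. Since `f̂ ∈ ℓᵖ` vanishes at infinity and the dual is infinite, `λ` is the limit of
`x̂`, so `|λ| ≥ δ`. Write `x* x = a + h` with `a = |λ|²`; then `‖h‖ ≤ 1 - a`, and `ĥ = |x̂|² - a` is
real and at least `δ² - a`. For odd `n` the element `aⁿ + hⁿ` is `a + h` times a cofactor `S` with
`‖S‖ ≤ (a + (1 - a))ⁿ⁻¹ = 1`, and its transform is at least `Δ` because odd powers are monotone.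

Since `p ≤ 2n`, `ĥⁿ` is square summable. Hence `1/(aⁿ + ĥⁿ)` is the constant `a⁻ⁿ` plus an `ℓ²`
function. By Riesz–Fischer this function is the transform of some `g ∈ L²(G) ⊆ L¹(G)`, and `g ∈
A_p(G)` because `ℓ² ⊆ ℓᵖ`. The inverse is `x* S (a⁻ⁿ + g)`.

This identity is checked on transforms and pulled back by `hat_injective`, which rests on the
uniqueness theorem `fourier_injective` and on `infinite_pontryaginDual`. Uniqueness is proved by
Gelfand theory: if `f̂ = 0`, every character of the unitization of `L¹(G)` sends `f` to 0 or to some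
`f̂(γ) = 0`, so convolution by `f` on `L²(G)` has spectrum in `{0}`. It is a normal operator, hence
zero, and the regular representation is faithful. -/

theorem chi_inv {G : Type*} [CommGroup G] [TopologicalSpace G] (γ : PontryaginDual G) (t : G) :
    chi γ t⁻¹ = conj (chi γ t) := by
  simp only [chi, map_inv]
  exact Circle.coe_inv_eq_conj _

/-! ### The involution of `L¹(G)`. -/

section Involution

variable {G : Type*} [CommGroup G] [TopologicalSpace G] [IsTopologicalGroup G] [CompactSpace G]
  [MeasurableSpace G] [BorelSpace G]

theorem integrable_conj_inv (f : L1 G) : Integrable (fun t => conj (f t⁻¹)) (haar G) := by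
  have h := (L1.integrable_coeFn f).comp_inv
  exact (Complex.conjLIE.integrable_comp_iff).2 h

/-- The involution `f*(t) = conj (f (t⁻¹))` of `L¹(G)`. -/
def starL1 (f : L1 G) : L1 G := (integrable_conj_inv f).toL1 _

theorem starL1_coe (f : L1 G) : starL1 f =ᵐ[haar G] fun t => conj (f t⁻¹) :=
  Integrable.coeFn_toL1 _

theorem norm_starL1 (f : L1 G) : ‖starL1 f‖ = ‖f‖ := by
  rw [L1.norm_eq_integral_norm, L1.norm_eq_integral_norm, ← integral_inv_eq_self]
  refine integral_congr_ae ?_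
  filter_upwards [(Measure.measurePreserving_inv (haar G)).quasiMeasurePreserving.ae
    (starL1_coe f)] with t ht
  rw [ht]
  simp

/-- Pairing with `f*` is the conjugate of a pairing with `f`. -/
theorem integral_starL1_mul (f : L1 G) (φ : G → ℂ) :
    ∫ t, starL1 f t * φ t ∂(haar G) = conj (∫ t, f t * conj (φ t⁻¹) ∂(haar G)) := by
  rw [← integral_conj, ← integral_inv_eq_self]
  refine integral_congr_ae ?_
  filter_upwards [(Measure.measurePreserving_inv (haar G)).quasiMeasurePreserving.ae
    (starL1_coe f)] with t ht
  rw [ht]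
  simp

theorem fourier_starL1 (f : L1 G) (γ : PontryaginDual G) :
    fourier (starL1 f) γ = conj (fourier f γ) := by
  rw [fourier, integral_starL1_mul, fourier]
  simp only [chi_inv, Complex.conj_conj]

end Involution

/-! ### The regular representation of `L¹(G)` on `L²(G)` and its faithfulness. -/

section Regular

variable (G : Type*) [CommGroup G] [TopologicalSpace G] [IsTopologicalGroup G] [CompactSpace G]
  [MeasurableSpace G] [BorelSpace G]

instance two_ne_top_fact : Fact ((2 : ℝ≥0∞) ≠ ∞) := ⟨ENNReal.ofNat_ne_top⟩

/-- The Hilbert space `L²(G)`. -/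
abbrev L2 : Type _ := Lp ℂ 2 (haar G)

variable {G}

/-- Translation by `s` as an isometry of `L²(G)`. -/
def translate (s : G) : L2 G →ₗᵢ[ℂ] L2 G where
  toFun v := DomMulAct.mk s⁻¹ • v
  map_add' := DomMulAct.smul_Lp_add _
  map_smul' _ _ := smul_comm _ _ _
  norm_map' := DomMulAct.norm_smul_Lp _

theorem translate_coe (s : G) (v : L2 G) : translate s v =ᵐ[haar G] fun t => v (s⁻¹ * t) :=
  DomMulAct.smul_Lp_ae_eq _ _

theorem translate_mul (s r : G) (v : L2 G) :
    translate (s * r) v = translate s (translate r v) := by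
  change DomMulAct.mk (s * r)⁻¹ • v = DomMulAct.mk s⁻¹ • DomMulAct.mk r⁻¹ • v
  rw [← mul_smul, ← DomMulAct.mk_mul, mul_inv]
  congr 2
  exact mul_comm _ _

theorem translate_one (v : L2 G) : translate 1 v = v := by
  change DomMulAct.mk (1 : G)⁻¹ • v = v
  rw [inv_one, DomMulAct.mk_one, one_smul]

theorem continuous_translate (v : L2 G) : Continuous fun s : G => translate s v := by
  change Continuous fun s : G => DomMulAct.mk s⁻¹ • v
  exact (DomMulAct.continuous_mk.comp continuous_inv).smul continuous_const

theorem inner_translate_right (s : G) (v w : L2 G) :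
    inner ℂ v (translate s w) = inner ℂ (translate s⁻¹ v) w := by
  rw [← (translate s⁻¹).inner_map_map v, ← translate_mul, inv_mul_cancel, translate_one]

theorem integrable_translate (f : L1 G) (v : L2 G) :
    Integrable (fun s => f s • translate s v) (haar G) := by
  refine (L1.integrable_coeFn f).smul_of_top_left ?_
  refine memLp_top_of_bound ((continuous_translate v).stronglyMeasurable_of_hasCompactSupport
    (HasCompactSupport.of_compactSpace _)).aestronglyMeasurable ‖v‖ ?_
  exact Filter.Eventually.of_forall fun s => ((translate s).norm_map v).le

/-- Convolution by `f ∈ L¹(G)` as an operator on `L²(G)`. -/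
def convOp (f : L1 G) : L2 G →L[ℂ] L2 G :=
  LinearMap.mkContinuous
    { toFun := fun v => ∫ s, f s • translate s v ∂(haar G)
      map_add' := fun v w => by
        simp only [map_add, smul_add]
        exact integral_add (integrable_translate f v) (integrable_translate f w)
      map_smul' := fun c v => by
        simp only [map_smul, RingHom.id_apply]
        rw [← integral_smul]
        simp only [smul_comm c] } ‖f‖
    (fun v => by
      rw [L1.norm_eq_integral_norm f, ← integral_mul_const]
      refine norm_integral_le_of_norm_le ((L1.integrable_coeFn f).norm.mul_const _)
        (Filter.Eventually.of_forall fun s => ?_)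
      rw [norm_smul, LinearIsometry.norm_map])

theorem convOp_apply (f : L1 G) (v : L2 G) :
    convOp f v = ∫ s, f s • translate s v ∂(haar G) := rfl

theorem inner_convOp (f : L1 G) (v w : L2 G) :
    inner ℂ w (convOp f v) = ∫ s, f s * inner ℂ w (translate s v) ∂(haar G) := by
  rw [convOp_apply, ← innerSL_apply_apply ℂ,
    ← ContinuousLinearMap.integral_comp_comm _ (integrable_translate f v)]
  simp only [map_smul, innerSL_apply_apply, smul_eq_mul]

/-- Translations are unitary, so passing to the adjoint replaces `s` by `s⁻¹` and conjugates the
weight, which is the involution of `L¹(G)`. -/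
theorem adjoint_convOp (f : L1 G) : ContinuousLinearMap.adjoint (convOp f) = convOp (starL1 f) := by
  refine ContinuousLinearMap.ext fun v => ext_inner_left ℂ fun w => ?_
  rw [ContinuousLinearMap.adjoint_inner_right, ← inner_conj_symm, inner_convOp, inner_convOp,
    integral_starL1_mul]
  simp only [inner_translate_right, inv_inv, inner_conj_symm]

/-- The matrix coefficient `s ↦ ⟪w, translate s v⟫` is bounded and continuous, so the Fubini
argument inside `pair_mulL1` applies to it directly. -/
theorem convOp_mulL1 (f g : L1 G) : convOp (mulL1 f g) = convOp f * convOp g := by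
  refine ContinuousLinearMap.ext fun v => ext_inner_left ℂ fun w => ?_
  have hc : Continuous fun s : G => inner ℂ w (translate s v) :=
    continuous_const.inner (continuous_translate v)
  have hb : ∀ s : G, ‖inner ℂ w (translate s v)‖ ≤ ‖w‖ * ‖v‖ := fun s => by
    rw [← (translate s).norm_map v]
    exact norm_inner_le_norm _ _
  rw [mul_apply_eq_comp, inner_convOp, inner_convOp,
    ← pair_apply _ hc.measurable _ hb, pair_mulL1]
  refine integral_congr_ae (Filter.Eventually.of_forall fun s => ?_)
  simp only
  rw [inner_translate_right, inner_convOp, pair_apply, ← integral_mul_left_eq_self _ s]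
  congr 1
  refine integral_congr_ae ?_
  filter_upwards [(measurePreserving_mul_left (haar G) s).quasiMeasurePreserving.ae
    (shift_coe s g)] with t ht
  rw [ht, inv_mul_cancel_left, translate_mul, inner_translate_right]

theorem convOp_add (f g : L1 G) : convOp (f + g) = convOp f + convOp g := by
  refine ContinuousLinearMap.ext fun v => ?_
  rw [add_apply, convOp_apply, convOp_apply, convOp_apply,
    ← integral_add (integrable_translate f v) (integrable_translate g v)]
  refine integral_congr_ae ?_
  filter_upwards [Lp.coeFn_add f g] with t ht
  rw [ht, Pi.add_apply, add_smul]

theorem convOp_smul (c : ℂ) (f : L1 G) : convOp (c • f) = c • convOp f := by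
  refine ContinuousLinearMap.ext fun v => ?_
  rw [smul_apply, convOp_apply, convOp_apply, ← integral_smul]
  refine integral_congr_ae ?_
  filter_upwards [Lp.coeFn_smul c f] with t ht
  rw [ht, Pi.smul_apply, smul_assoc]

/-- The adjoint is again a convolution operator, and convolution is commutative. Normality is what
later turns spectral radius zero into norm zero. -/
instance isStarNormal_convOp (f : L1 G) : IsStarNormal (convOp f) := by
  refine ⟨?_⟩
  rw [ContinuousLinearMap.star_eq_adjoint, adjoint_convOp]
  change _ * _ = _ * _
  rw [← convOp_mulL1, mulL1_comm, convOp_mulL1]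

/-- The inclusion of `L²(G)` in `L¹(G)`. -/
def inclL1 : L2 G →L[ℂ] L1 G :=
  LinearMap.mkContinuous
    { toFun := fun v => ((Lp.memLp v).mono_exponent one_le_two).toLp v
      map_add' := fun v w => by
        rw [← MemLp.toLp_add]
        exact MemLp.toLp_congr _ _ (Lp.coeFn_add v w)
      map_smul' := fun c v => by
        rw [RingHom.id_apply, ← MemLp.toLp_const_smul]
        exact MemLp.toLp_congr _ _ (Lp.coeFn_smul c v) } 1
    (fun v => by
      rw [one_mul, Lp.norm_def v]
      change ‖((Lp.memLp v).mono_exponent one_le_two).toLp v‖ ≤ _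
      rw [Lp.norm_toLp]
      exact ENNReal.toReal_mono (Lp.eLpNorm_ne_top v)
        (eLpNorm_le_eLpNorm_of_exponent_le one_le_two (Lp.aestronglyMeasurable v)))

theorem inclL1_coe (v : L2 G) : inclL1 v =ᵐ[haar G] v :=
  ((Lp.memLp v).mono_exponent one_le_two).coeFn_toLp

theorem norm_inclL1_le (v : L2 G) : ‖inclL1 v‖ ≤ ‖v‖ := by
  rw [← one_mul ‖v‖]
  exact inclL1.le_of_opNorm_le (LinearMap.mkContinuous_norm_le _ zero_le_one _) v

theorem inclL1_translate (s : G) (v : L2 G) : inclL1 (translate s v) = shift s (inclL1 v) := by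
  refine Lp.ext ?_
  filter_upwards [inclL1_coe (translate s v), translate_coe s v, shift_coe s (inclL1 v),
    (measurePreserving_mul_left (haar G) s⁻¹).quasiMeasurePreserving.ae (inclL1_coe v)]
    with t h1 h2 h3 h4
  rw [h1, h2, h3, h4]

theorem inclL1_convOp (f : L1 G) (v : L2 G) : inclL1 (convOp f v) = mulL1 f (inclL1 v) := by
  rw [convOp_apply, ← ContinuousLinearMap.integral_comp_comm _ (integrable_translate f v),
    mulL1_eq]
  simp only [map_smul, inclL1_translate]

theorem denseRange_inclL1 : DenseRange (inclL1 : L2 G → L1 G) := by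
  refine (ContinuousMap.toLp_denseRange ℂ (haar G) ℂ ENNReal.one_ne_top).mono ?_
  rintro _ ⟨u, rfl⟩
  refine ⟨ContinuousMap.toLp 2 (haar G) ℂ u, Lp.ext ?_⟩
  filter_upwards [inclL1_coe (ContinuousMap.toLp 2 (haar G) ℂ u),
    ContinuousMap.coeFn_toLp (p := 2) (𝕜 := ℂ) (haar G) u,
    ContinuousMap.coeFn_toLp (p := 1) (𝕜 := ℂ) (haar G) u] with t h1 h2 h3
  rw [h1, h2, h3]

theorem shift_one (f : L1 G) : shift 1 f = f := by
  change DomMulAct.mk (1 : G)⁻¹ • f = f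
  rw [inv_one, DomMulAct.mk_one, one_smul]

/-- `L¹(G)` has an approximate identity; in particular its regular representation is faithful. -/
theorem eq_zero_of_forall_mulL1_eq_zero {f : L1 G} (hf : ∀ g, mulL1 g f = 0) : f = 0 := by
  by_contra hne
  have hpos : 0 < ‖f‖ := norm_pos_iff.2 hne
  -- Convolving `f` with the indicator of a small neighbourhood `U` of 1 gives `∫_U shift s f = 0`,
  -- so `m(U) f = ∫_U (f - shift s f)`. On `U` the integrand has norm strictly below `‖f‖`, which is
  -- a contradiction.
  have hU : {s : G | ‖shift s f - f‖ < ‖f‖} ∈ nhds (1 : G) := by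
    have hc : Continuous fun s : G => ‖shift s f - f‖ :=
      ((continuous_shift f).sub continuous_const).norm
    refine hc.continuousAt.eventually_lt continuousAt_const ?_
    simpa [shift_one] using hpos
  obtain ⟨U, hUs, hUo, hU1⟩ := mem_nhds_iff.1 hU
  have hm0 : haar G U ≠ 0 := (hUo.measure_pos (haar G) ⟨1, hU1⟩).ne'
  have hm : 0 < (haar G).real U := ENNReal.toReal_pos hm0 (measure_ne_top _ _)
  let g : L1 G := indicatorConstLp 1 hUo.measurableSet (measure_ne_top (haar G) U) (1 : ℂ)
  have hg : g =ᵐ[haar G] U.indicator fun _ => (1 : ℂ) := indicatorConstLp_coeFn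
  have h0 : ∫ s in U, shift s f ∂(haar G) = 0 := by
    rw [← hf g, mulL1_eq, ← integral_indicator hUo.measurableSet]
    refine integral_congr_ae ?_
    filter_upwards [hg] with s hs
    rw [hs]
    by_cases h : s ∈ U <;> simp [h]
  have hi : IntegrableOn (fun s => shift s f) U (haar G) := by
    refine (Integrable.of_bound (stronglyMeasurable_shift f).aestronglyMeasurable ‖f‖ ?_).integrableOn
    exact Filter.Eventually.of_forall fun s => (norm_shift s f).le
  have hc : IntegrableOn (fun _ : G => f) U (haar G) := integrableOn_const (measure_ne_top _ _)
  have h1 : ∫ s in U, (f - shift s f) ∂(haar G) = (haar G).real U • f := by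
    rw [integral_sub hc hi, h0, sub_zero, setIntegral_const]
  have h2 : 0 < ∫ s in U, (‖f‖ - ‖f - shift s f‖) ∂(haar G) := by
    refine (setIntegral_pos_iff_support_of_nonneg_ae ?_ ?_).2 ?_
    · filter_upwards [ae_restrict_mem hUo.measurableSet] with s hs
      have := hUs hs
      simp only [Set.mem_ofPred_eq, norm_sub_rev] at this
      simp only [Pi.zero_apply]
      linarith [norm_sub_rev f (shift s f)]
    · exact hc.norm.sub (hc.sub hi).norm
    · refine (pos_iff_ne_zero.2 hm0).trans_le (measure_mono fun s hs => ⟨?_, hs⟩)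
      have := hUs hs
      simp only [Set.mem_ofPred_eq] at this
      rw [norm_sub_rev] at this
      exact (sub_pos.2 this).ne'
  have hd : IntegrableOn (fun s => ‖f - shift s f‖) U (haar G) := (hc.sub hi).norm
  rw [integral_sub hc.norm hd, setIntegral_const] at h2
  have h3 := norm_integral_le_integral_norm (μ := (haar G).restrict U) fun s => f - shift s f
  rw [h1, norm_smul, Real.norm_of_nonneg hm.le] at h3
  rw [smul_eq_mul] at h2
  linarith

/-- `L²(G)` is dense in `L¹(G)` and the two convolutions agree there, so an `f` that acts as zero on
`L²(G)` annihilates all of `L¹(G)`. -/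
theorem convOp_eq_zero {f : L1 G} (hf : convOp f = 0) : f = 0 := by
  refine eq_zero_of_forall_mulL1_eq_zero fun g => ?_
  have h : Set.EqOn (mulRight f : L1 G → L1 G) (fun _ => 0) (Set.range inclL1) := by
    rintro _ ⟨v, rfl⟩
    change mulL1 _ _ = 0
    rw [mulL1_comm, ← inclL1_convOp, hf, zero_apply, map_zero]
  exact congrFun (Continuous.ext_on denseRange_inclL1 (mulRight f).continuous continuous_const h) g

end Regular

/-! ### Characters of `L¹(G)`, uniqueness of Fourier transforms, infinitude of the dual. -/

section Uniqueness

variable {G : Type*} [CommGroup G] [TopologicalSpace G] [IsTopologicalGroup G] [CompactSpace G]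
  [MeasurableSpace G] [BorelSpace G]

/-- Every nonzero multiplicative functional on `L¹(G)` is the evaluation of the Fourier transform
at some character of `G`. -/
theorem exists_eq_fourier (φ : L1 G →L[ℂ] ℂ) (hφ : ∀ f g, φ (mulL1 f g) = φ f * φ g)
    (hne : φ ≠ 0) : ∃ γ : PontryaginDual G, ∀ f, φ f = fourier f γ := by
  obtain ⟨g, hg⟩ : ∃ g, φ g ≠ 0 := by
    by_contra! h
    exact hne (ContinuousLinearMap.ext h)
  -- The character is recovered from the factor by which translation scales `φ`. It does not depend
  -- on `g`, since `g * shift s f = f * shift s g`.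
  let c : G → ℂ := fun s => φ (shift s g) / φ g
  have hc : ∀ s f, φ (shift s f) = c s * φ f := fun s f => by
    have h : φ g * φ (shift s f) = φ f * φ (shift s g) := by
      rw [← hφ, ← hφ, shift_mulL1, shift_mulL1, mulL1_comm]
    simp only [c]
    field_simp
    linear_combination h
  have h1 : c 1 = 1 := by simp only [c, shift_one, div_self hg]
  have hmul : ∀ s r, c (s * r) = c s * c r := fun s r => by
    have h : c (s * r) * φ g = c s * (c r * φ g) := by
      rw [← hc, ← shift_shift, hc, hc]
    exact mul_right_cancel₀ hg (h.trans (mul_assoc _ _ _).symm)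
  let ch : G →* ℂ := { toFun := c, map_one' := h1, map_mul' := hmul }
  -- The powers `c s ^ n = c (s ^ n)` are bounded uniformly in `n`, which excludes modulus above 1.
  have hle : ∀ s, ‖c s‖ ≤ 1 := fun s => by
    by_contra! hlt
    obtain ⟨n, hn⟩ := pow_unbounded_of_one_lt (‖φ‖ * ‖g‖ / ‖φ g‖) hlt
    refine hn.not_ge ?_
    rw [← norm_pow, show c s ^ n = c (s ^ n) from (map_pow ch s n).symm]
    simp only [c, norm_div]
    gcongr
    rw [← norm_shift (s ^ n) g]
    exact φ.le_opNorm _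
  have hnorm : ∀ s, ‖c s‖ = 1 := fun s => by
    refine le_antisymm (hle s) ?_
    have h : ‖c s‖ * ‖c s⁻¹‖ = 1 := by
      rw [← norm_mul, ← hmul, mul_inv_cancel, h1, norm_one]
    nlinarith [hle s⁻¹, norm_nonneg (c s)]
  have hcont : Continuous c := (φ.continuous.comp (continuous_shift g)).div_const _
  -- The inverse compensates for the complex conjugate in the definition of the Fourier transform.
  let γ : PontryaginDual G := show G →ₜ* Circle from
    { toFun := fun s => ⟨c s⁻¹, mem_sphere_zero_iff_norm.2 (hnorm _)⟩
      map_one' := Subtype.ext (by simpa using h1)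
      map_mul' := fun s r => Subtype.ext (by
        change c (s * r)⁻¹ = c s⁻¹ * c r⁻¹
        rw [mul_inv, hmul])
      continuous_toFun := (hcont.comp continuous_inv).subtype_mk _ }
  have hγ : ∀ s, conj (chi γ s) = c s := fun s => by
    rw [← chi_inv]
    change c s⁻¹⁻¹ = c s
    rw [inv_inv]
  refine ⟨γ, fun f => mul_right_cancel₀ hg ?_⟩
  rw [← hφ, mulL1_eq, ← ContinuousLinearMap.integral_comp_comm _ (integrable_shift f g), fourier,
    ← integral_mul_const]
  simp only [map_smul, hc, hγ, smul_eq_mul, mul_assoc]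

/-- The Banach algebra structure of `L¹(G)`. -/
instance : NonUnitalNormedCommRing (L1 G) where
  mul := mulL1
  left_distrib := mulL1_add
  right_distrib f g h := by
    change mulL1 _ _ = mulL1 _ _ + mulL1 _ _
    simp only [mulL1_comm _ h, mulL1_add]
  zero_mul f := by
    change mulL1 _ _ = _
    simpa [mulL1_comm] using mulL1_smul 0 f 0
  mul_zero f := by
    change mulL1 _ _ = _
    simpa using mulL1_smul 0 f 0
  mul_assoc := mulL1_assoc
  mul_comm := mulL1_comm
  dist_eq := dist_eq_norm_neg_add
  norm_mul_le := norm_mulL1_le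

instance : SMulCommClass ℂ (L1 G) (L1 G) where
  smul_comm c f g := (mulL1_smul c f g).symm

instance : IsScalarTower ℂ (L1 G) (L1 G) where
  smul_assoc c f g := by
    change mulL1 _ _ = c • mulL1 _ _
    simp only [mulL1_comm _ g, mulL1_smul]

/-- Commutativity lets Gelfand theory describe the spectrum by values of characters. -/
instance : NormedCommRing (WithLp 1 (Unitization ℂ (L1 G))) where
  mul_comm x y := congrArg (WithLp.toLp 1) (mul_comm (WithLp.ofLp x) (WithLp.ofLp y))

/-- The regular representation of the unitization of `L¹(G)` on `L²(G)`. -/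
def regularRep : WithLp 1 (Unitization ℂ (L1 G)) →ₐ[ℂ] (L2 G →L[ℂ] L2 G) :=
  (Unitization.lift
    { toFun := convOp
      map_smul' := convOp_smul
      map_zero' := by simpa using convOp_smul 0 (0 : L1 G)
      map_add' := convOp_add
      map_mul' := convOp_mulL1 }).comp
    (WithLp.unitizationAlgEquiv ℂ : WithLp 1 (Unitization ℂ (L1 G)) ≃ₐ[ℂ] _).toAlgHom

theorem regularRep_inr (f : L1 G) :
    regularRep (WithLp.toLp 1 (f : Unitization ℂ (L1 G))) = convOp f := by
  simp [regularRep]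

/-- The uniqueness theorem for the Fourier transform on `L¹(G)`. -/
theorem fourier_injective : Function.Injective (fourier : L1 G → PontryaginDual G → ℂ) := by
  suffices h : ∀ f : L1 G, fourier f = 0 → f = 0 by
    intro f g hfg
    rw [← sub_eq_zero]
    refine h _ ?_
    rw [sub_eq_add_neg, ← neg_one_smul ℂ g, fourier_add, fourier_smul, hfg]
    simp
  intro f hf
  have hs : spectrum ℂ (convOp f) ⊆ {0} := by
    rw [← regularRep_inr]
    refine (AlgHom.spectrum_apply_subset regularRep _).trans fun z hz => ?_
    obtain ⟨φ, rfl⟩ := WeakDual.CharacterSpace.mem_spectrum_iff_exists.1 hz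
    let i : L1 G →L[ℂ] WithLp 1 (Unitization ℂ (L1 G)) :=
      { toFun := fun f => WithLp.toLp 1 (f : Unitization ℂ (L1 G))
        map_add' := fun f g => by simp
        map_smul' := fun c f => by simp
        cont := WithLp.unitization_isometry_inr.continuous }
    let ψ : L1 G →L[ℂ] ℂ := (WeakDual.CharacterSpace.toCLM φ).comp i
    have hψ : ∀ f g, ψ (mulL1 f g) = ψ f * ψ g := fun f g => by
      change φ (i (mulL1 f g)) = φ (i f) * φ (i g)
      rw [← map_mul]
      congr 1
      exact congrArg (WithLp.toLp 1) (Unitization.inr_mul ℂ f g)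
    change ψ f = 0
    -- The zero case is the character of the unitization that kills `L¹(G)`.
    by_cases h0 : ψ = 0
    · rw [h0, zero_apply]
    · obtain ⟨γ, hγ⟩ := exists_eq_fourier ψ hψ h0
      rw [hγ, hf, Pi.zero_apply]
  have hr : spectralRadius ℂ (convOp f) ≤ 0 :=
    iSup₂_le fun z hz => by simp [Set.mem_singleton_iff.1 (hs hz)]
  rw [IsStarNormal.spectralRadius_eq_nnnorm] at hr
  exact convOp_eq_zero (by simpa using hr)

/-- The characters of `G` separate points. -/
theorem eq_one_of_forall_apply_eq_one [T2Space G] {s : G}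
    (hs : ∀ γ : PontryaginDual G, γ s = 1) : s = 1 := by
  by_contra hne
  -- If every character is 1 at `s`, translation by `s` fixes all Fourier coefficients and hence
  -- every function. A Urysohn function separating 1 from `s⁻¹` is not fixed.
  obtain ⟨u, hu0, hu1, -⟩ := exists_continuous_zero_one_of_isClosed
    (isClosed_singleton (x := (1 : G))) (isClosed_singleton (x := s⁻¹))
    (by simpa using hne)
  let v : C(G, ℂ) := ⟨fun t => u t, by fun_prop⟩
  let g : L1 G := ContinuousMap.toLp 1 (haar G) ℂ v
  have hg : g =ᵐ[haar G] v := ContinuousMap.coeFn_toLp (p := 1) (𝕜 := ℂ) (haar G) v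
  have hsg : shift s g = g := fourier_injective (funext fun γ => by
    rw [fourier_shift]
    simp [chi, hs])
  have hae : (fun t => v (s⁻¹ * t)) =ᵐ[haar G] v := by
    filter_upwards [shift_coe s g, hg,
      (measurePreserving_mul_left (haar G) s⁻¹).quasiMeasurePreserving.ae hg] with t h1 h2 h3
    rw [← h3, ← h1, hsg, h2]
  have heq := (Continuous.ae_eq_iff_eq (haar G) (by fun_prop) v.continuous).1 hae
  have h := congrFun heq 1
  have h0 : u 1 = 0 := hu0 rfl
  have h1 : u s⁻¹ = 1 := hu1 rfl
  simp [v, h0, h1] at h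

/-- If the dual had finite order `N`, all characters would take values in the `N`-th roots of unity.
As they separate points, `G` would embed in a finite set, and a finite Hausdorff group is discrete.
-/
theorem infinite_pontryaginDual [T2Space G] (hG : ¬ DiscreteTopology G) :
    Infinite (PontryaginDual G) := by
  refine not_finite_iff_infinite.1 fun hfin => hG ?_
  set N := Nat.card (PontryaginDual G)
  have hN0 : N ≠ 0 := Nat.card_pos.ne'
  have hpow : ∀ (γ : PontryaginDual G) (t : G), chi γ t ^ N = 1 := fun γ t => by
    have h : γ ^ N = 1 := pow_card_eq_one'
    let ev : PontryaginDual G →* Circle := ⟨⟨fun γ => γ t, rfl⟩, fun _ _ => rfl⟩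
    have h2 : (γ t) ^ N = 1 := by
      rw [← map_one ev, ← h, map_pow]
      rfl
    rw [chi, ← map_pow, h2, map_one]
  have hR : Finite {z : ℂ | z ^ N = 1} := by
    refine ((Polynomial.nthRootsFinset N (1 : ℂ)).finite_toSet.subset fun z hz => ?_).to_subtype
    exact (Polynomial.mem_nthRootsFinset (Nat.pos_of_ne_zero hN0) _).2 hz
  have hinj : Function.Injective fun (t : G) (γ : PontryaginDual G) =>
      (⟨chi γ t, hpow γ t⟩ : {z : ℂ | z ^ N = 1}) := fun s t hst => by
    rw [← mul_inv_eq_one]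
    refine eq_one_of_forall_apply_eq_one fun γ => Circle.ext ?_
    have h := congrFun hst γ
    simp only [Subtype.mk.injEq] at h
    change chi γ (s * t⁻¹) = 1
    rw [chi_mul, h, ← chi_mul, mul_inv_cancel]
    simp [chi]
  have : Finite G := Finite.of_injective _ hinj
  infer_instance

end Uniqueness

theorem chi_mul_conj_chi {G : Type*} [CommGroup G] [TopologicalSpace G]
    (γ γ' : PontryaginDual G) (t : G) :
    chi γ t * conj (chi γ' t) = chi (γ * γ'⁻¹) t := by
  rw [← chi_inv]
  change _ = Circle.coeHom (γ t * (γ' t)⁻¹)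
  rw [map_mul, chi, chi, map_inv]

/-! ### Orthogonality of characters and the Riesz–Fischer theorem. -/

section RieszFischer

variable {G : Type*} [CommGroup G] [TopologicalSpace G] [IsTopologicalGroup G] [CompactSpace G]
  [MeasurableSpace G] [BorelSpace G]

/-- A character as an element of `L²(G)`. -/
def chiL2 (γ : PontryaginDual G) : L2 G :=
  ContinuousMap.toLp 2 (haar G) ℂ ⟨chi γ, continuous_chi γ⟩

theorem chiL2_coe (γ : PontryaginDual G) : chiL2 γ =ᵐ[haar G] chi γ :=
  ContinuousMap.coeFn_toLp (p := 2) (𝕜 := ℂ) (haar G) ⟨chi γ, continuous_chi γ⟩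

theorem fourier_inclL1 (v : L2 G) (γ : PontryaginDual G) :
    fourier (inclL1 v) γ = inner ℂ (chiL2 γ) v := by
  rw [fourier, L2.inner_def]
  refine integral_congr_ae ?_
  filter_upwards [inclL1_coe v, chiL2_coe γ] with t h1 h2
  rw [h1, h2]
  simp

theorem integral_chi {γ : PontryaginDual G} (hγ : γ ≠ 1) : ∫ t, chi γ t ∂(haar G) = 0 := by
  obtain ⟨s, hs⟩ : ∃ s, chi γ s ≠ 1 := by
    by_contra! h
    exact hγ (PontryaginDual.ext fun s => Circle.ext (h s))
  have h : ∫ t, chi γ t ∂(haar G) = chi γ s * ∫ t, chi γ t ∂(haar G) := by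
    conv_lhs => rw [← integral_mul_left_eq_self _ s]
    simp only [chi_mul, integral_const_mul]
  have h2 : (chi γ s - 1) * ∫ t, chi γ t ∂(haar G) = 0 := by linear_combination -h
  exact (mul_eq_zero.1 h2).resolve_left (sub_ne_zero.2 hs)

theorem orthonormal_chiL2 : Orthonormal ℂ (chiL2 : PontryaginDual G → L2 G) := by
  classical
  refine orthonormal_iff_ite.2 fun γ γ' => ?_
  have h : inner ℂ (chiL2 γ) (chiL2 γ') = ∫ t, chi (γ' * γ⁻¹) t ∂(haar G) := by
    rw [L2.inner_def]
    refine integral_congr_ae ?_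
    filter_upwards [chiL2_coe γ, chiL2_coe γ'] with t h1 h2
    rw [h1, h2, ← chi_mul_conj_chi]
    simp
  rw [h]
  split_ifs with hγ
  · rw [hγ, mul_inv_cancel]
    simp [chi]
  · exact integral_chi fun h => hγ (mul_inv_eq_one.1 h).symm

/-- The Riesz–Fischer theorem on `G`. -/
theorem exists_fourier_eq (b : lp (fun _ : PontryaginDual G => ℂ) 2) :
    ∃ g : L1 G, fourier g = b ∧ ‖g‖ ≤ ‖b‖ := by
  have hO : Orthonormal ℂ (chiL2 : PontryaginDual G → L2 G) := orthonormal_chiL2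
  -- Orthonormality alone embeds `ℓ²` of the dual isometrically in `L²(G)`; completeness of the
  -- characters is not needed.
  let I := hO.orthogonalFamily.linearIsometry
  refine ⟨inclL1 (I b), funext fun γ => ?_, (norm_inclL1_le _).trans (I.norm_map b).le⟩
  rw [fourier_inclL1]
  have h := (hO.orthogonalFamily.hasSum_linearIsometry b).mapL (innerSL ℂ (chiL2 γ))
  have h1 : HasSum (fun γ' => inner ℂ (chiL2 γ) (b γ' • chiL2 γ')) (inner ℂ (chiL2 γ) (I b)) := h
  have h2 : HasSum (fun γ' => inner ℂ (chiL2 γ) (b γ' • chiL2 γ'))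
      (inner ℂ (chiL2 γ) (b γ • chiL2 γ)) := hasSum_single γ fun γ' hne => by
    rw [inner_smul_right, hO.2 hne.symm, mul_zero]
  rw [h1.unique h2, inner_smul_right, inner_self_eq_norm_sq_to_K, hO.1]
  simp

end RieszFischer

/-! ### Elementary inequalities. -/

section Estimates

/-- The norm of `ℓ^q` is dominated by the norm of `ℓ^p` for `p ≤ q`. -/
theorem summable_rpow_of_le {ι : Type*} {c : ι → ℝ} (hc : ∀ i, 0 ≤ c i) {p q : ℝ} (hp : 0 < p)
    (hpq : p ≤ q) {M : ℝ} (hM : 0 ≤ M) (hs : Summable fun i => c i ^ p)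
    (hle : ∑' i, c i ^ p ≤ M ^ p) :
    Summable (fun i => c i ^ q) ∧ ∑' i, c i ^ q ≤ M ^ q := by
  have hcM : ∀ i, c i ≤ M := fun i =>
    (Real.rpow_le_rpow_iff (hc i) hM hp).1
      ((hs.le_tsum i fun j _ => Real.rpow_nonneg (hc j) p).trans hle)
  have h : ∀ i, c i ^ q ≤ c i ^ p * M ^ (q - p) := fun i => by
    rw [show q = p + (q - p) by ring, Real.rpow_add_of_nonneg (hc i) hp.le (sub_nonneg.2 hpq),
      add_sub_cancel_left]
    exact mul_le_mul_of_nonneg_left (Real.rpow_le_rpow (hc i) (hcM i) (sub_nonneg.2 hpq))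
      (Real.rpow_nonneg (hc i) p)
  have hs' : Summable fun i => c i ^ q :=
    Summable.of_nonneg_of_le (fun i => Real.rpow_nonneg (hc i) q) h (hs.mul_right _)
  refine ⟨hs', (hs'.tsum_le_tsum h (hs.mul_right _)).trans ?_⟩
  rw [tsum_mul_right]
  calc _ ≤ M ^ p * M ^ (q - p) :=
        mul_le_mul_of_nonneg_right hle (Real.rpow_nonneg hM _)
    _ = M ^ q := by
        rw [← Real.rpow_add_of_nonneg hM hp.le (sub_nonneg.2 hpq), add_sub_cancel]

/-- The summands are those of the binomial expansion of `(a + b) ^ (n - 1)`, with the coefficients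
(all at least 1) dropped. -/
theorem geom_sum₂_le_one {a b : ℝ} (ha : 0 ≤ a) (hb : 0 ≤ b) (hab : a + b ≤ 1) {n : ℕ}
    (hn : n ≠ 0) : ∑ i ∈ Finset.range n, a ^ i * b ^ (n - 1 - i) ≤ 1 := by
  obtain ⟨m, rfl⟩ := Nat.exists_eq_succ_of_ne_zero hn
  refine le_trans ?_ (pow_le_one₀ (n := m) (add_nonneg ha hb) hab)
  rw [add_pow]
  refine Finset.sum_le_sum fun i hi => ?_
  have h : (1 : ℝ) ≤ m.choose i := by
    exact_mod_cast Nat.choose_pos (Nat.lt_succ_iff.1 (Finset.mem_range.1 hi))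
  exact le_mul_of_one_le_right (by positivity) h

/-- Odd powers are monotone, so `tⁿ ≥ -(a - δ²)ⁿ`, and `a ≤ 1` gives `a - δ² ≤ a (1 - δ²)`. Thus `aⁿ
+ tⁿ ≥ aⁿ (1 - (1 - δ²)ⁿ)`, and `aⁿ ≥ δ²ⁿ`. -/
theorem le_pow_add_pow_of_odd {δ a t : ℝ} (hδa : δ ^ 2 ≤ a) (ha : a ≤ 1)
    (ht : δ ^ 2 - a ≤ t) {n : ℕ} (hn : Odd n) :
    δ ^ (2 * n) * (1 - (1 - δ ^ 2) ^ n) ≤ a ^ n + t ^ n := by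
  have h0 : 0 ≤ 1 - δ ^ 2 := by linarith
  have h1 : -(a - δ ^ 2) ^ n ≤ t ^ n := by
    rw [← hn.neg_pow, neg_sub]
    exact hn.strictMono_pow.monotone ht
  have h2 : (a - δ ^ 2) ^ n ≤ a ^ n * (1 - δ ^ 2) ^ n := by
    rw [← mul_pow]
    exact pow_le_pow_left₀ (by linarith) (by nlinarith [sq_nonneg δ]) n
  have h3 : δ ^ (2 * n) ≤ a ^ n := by
    rw [pow_mul]
    exact pow_le_pow_left₀ (sq_nonneg δ) hδa n
  have h4 : (1 - δ ^ 2) ^ n ≤ 1 := pow_le_one₀ h0 (by linarith [sq_nonneg δ])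
  nlinarith [mul_le_mul_of_nonneg_right h3 (sub_nonneg.2 h4)]

end Estimates

variable {G : Type*} [CommGroup G] [TopologicalSpace G] [IsTopologicalGroup G] [CompactSpace G]
  [MeasurableSpace G] [BorelSpace G] {p : ℝ}

/-! ### Involution, decay of transforms and square-summable data in `A_p(G)`. -/

namespace Ap

/-- The involution of `A_p(G)`. -/
def star (f : Ap G p) : Ap G p :=
  ⟨starL1 (toL1 f), f.2.mono' fun γ => by rw [fourier_starL1, RCLike.norm_conj]; rfl⟩

theorem toL1_star (f : Ap G p) : toL1 (star f) = starL1 (toL1 f) := rfl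

variable [hp : Fact (1 ≤ p)]

theorem summable_fourier (f : Ap G p) :
    Summable fun γ : PontryaginDual G => ‖fourier (toL1 f) γ‖ ^ p := by
  have h0 : 0 < p := zero_lt_one.trans_le hp.out
  have h : (ENNReal.ofReal p).toReal = p := ENNReal.toReal_ofReal h0.le
  have := (memℓp_gen_iff (by rwa [h])).1 (lp.memℓp (toLp f))
  rwa [h] at this

theorem tsum_fourier_le (f : Ap G p) :
    ∑' γ : PontryaginDual G, ‖fourier (toL1 f) γ‖ ^ p ≤ ‖f‖ ^ p := by
  have h0 : 0 < p := zero_lt_one.trans_le hp.out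
  have h : (ENNReal.ofReal p).toReal = p := ENNReal.toReal_ofReal h0.le
  have h1 := lp.norm_rpow_eq_tsum (by rwa [h]) (toLp f)
  rw [h] at h1
  refine h1.symm.trans_le (Real.rpow_le_rpow (norm_nonneg _) ?_ h0.le)
  rw [norm_def]
  linarith [norm_nonneg (toL1 f)]

theorem tendsto_fourier (f : Ap G p) :
    Filter.Tendsto (fourier (toL1 f)) Filter.cofinite (nhds 0) := by
  have h0 : 0 < p := zero_lt_one.trans_le hp.out
  have h := (summable_fourier f).tendsto_cofinite_zero.rpow_const (p := p⁻¹)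
    (Or.inr (inv_nonneg.2 h0.le))
  rw [Real.zero_rpow (inv_ne_zero h0.ne')] at h
  refine tendsto_zero_iff_norm_tendsto_zero.2 (h.congr fun γ => ?_)
  exact Real.rpow_rpow_inv (norm_nonneg _) h0.ne'

theorem norm_star (f : Ap G p) : ‖star f‖ = ‖f‖ := by
  rw [norm_def, norm_def, norm_toLp, norm_toLp, toL1_star, norm_starL1]
  simp only [fourier_starL1, RCLike.norm_conj]

/-- Every square summable function on the dual group is the Fourier transform of an element of
`A_p(G)` if `2 ≤ p`. -/
theorem exists_fourier_eq_of_summable_sq (h2 : 2 ≤ p) {b : PontryaginDual G → ℂ}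
    (hb : Summable fun γ => ‖b γ‖ ^ (2 : ℝ)) {B : ℝ} (hB : 0 ≤ B)
    (hle : ∑' γ, ‖b γ‖ ^ (2 : ℝ) ≤ B ^ (2 : ℝ)) :
    ∃ g : Ap G p, fourier (toL1 g) = b ∧ ‖g‖ ≤ 2 * B := by
  have h0 : 0 < p := zero_lt_one.trans_le hp.out
  have h : (ENNReal.ofReal p).toReal = p := ENNReal.toReal_ofReal h0.le
  have ht : (2 : ℝ≥0∞).toReal = 2 := rfl
  obtain ⟨g, hg, hgb⟩ := exists_fourier_eq (G := G) ⟨b, memℓp_gen (by rwa [ht])⟩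
  obtain ⟨hs, hsle⟩ := summable_rpow_of_le (fun γ => norm_nonneg (b γ)) two_pos h2 hB hb hle
  have hg' : fourier g = b := hg
  have hmem : g ∈ apSubmodule G p := by
    change Memℓp (fourier g) _
    rw [hg']
    exact memℓp_gen (by rwa [h])
  let g' : Ap G p := ⟨g, hmem⟩
  refine ⟨g', hg', ?_⟩
  -- The factor 2: the `L¹` norm and the `ℓᵖ` norm are each at most `B`.
  rw [norm_def, two_mul]
  refine add_le_add (hgb.trans ?_) ?_
  · exact lp.norm_le_of_tsum_le (by norm_num) hB hle
  · refine lp.norm_le_of_tsum_le (by rwa [h]) hB ?_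
    rw [h, toLp_coe]
    change ∑' γ, ‖fourier g γ‖ ^ p ≤ _
    rwa [hg']

end Ap

/-! ### Inversion in the unitization. -/

namespace ApUnit

variable [hp : Fact (1 ≤ p)]

theorem norm_def (x : ApUnit G p) : ‖x‖ = ‖(WithLp.ofLp x).fst‖ + ‖(WithLp.ofLp x).snd‖ :=
  WithLp.unitization_norm_def x

theorem ofLp_one : WithLp.ofLp (1 : ApUnit G p) = 1 := rfl

/-- Needed to bound norms of powers including exponent 0, which occurs in the cofactor `S`. -/
instance : NormOneClass (ApUnit G p) :=
  ⟨by rw [norm_def, ofLp_one, Unitization.fst_one, Unitization.snd_one]; simp⟩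

/-- The transform `x ↦ x̂` as a homomorphism of algebras. -/
def hatHom : ApUnit G p →ₐ[ℂ] (PontryaginDual G → ℂ) where
  toFun := hat
  map_one' := by
    funext γ
    simp [hat, ofLp_one, fourier_zero]
  map_mul' x y := by
    funext γ
    simp only [hat, WithLp.unitization_mul, Unitization.fst_mul, Unitization.snd_mul, map_add,
      map_smul, fourier_add, fourier_smul, Ap.toL1_mul, fourier_mulL1, Pi.add_apply,
      Pi.smul_apply, Pi.mul_apply, smul_eq_mul]
    ring
  map_zero' := by
    funext γ
    simp [hat, fourier_zero]
  map_add' x y := by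
    funext γ
    simp only [hat, WithLp.ofLp_add, Unitization.fst_add, Unitization.snd_add, map_add,
      fourier_add, Pi.add_apply]
    ring
  commutes' c := by
    funext γ
    simp [hat, fourier_zero, Unitization.algebraMap_eq_inl]

theorem hatHom_apply (x : ApUnit G p) : hatHom x = hat x := rfl

theorem tendsto_hat (x : ApUnit G p) :
    Filter.Tendsto (hat x) Filter.cofinite (nhds (WithLp.ofLp x).fst) := by
  have h := (Ap.tendsto_fourier (WithLp.ofLp x).snd).const_add (WithLp.ofLp x).fst
  rwa [add_zero] at h

/-- The scalar part is the limit of the transform at infinity. This limit is unique because the dual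
is infinite, which is where non-discreteness of `G` enters. The rest is `fourier_injective`. -/
theorem hat_injective [Infinite (PontryaginDual G)] :
    Function.Injective (hat : ApUnit G p → PontryaginDual G → ℂ) := fun x y hxy => by
  have h1 : (WithLp.ofLp x).fst = (WithLp.ofLp y).fst :=
    tendsto_nhds_unique (tendsto_hat x) (hxy ▸ tendsto_hat y)
  have h2 : (WithLp.ofLp x).snd = (WithLp.ofLp y).snd :=
    Ap.toL1_injective (fourier_injective (funext fun γ => by
      have := congrFun hxy γ
      rw [hat, hat, h1] at this
      exact add_left_cancel this))
  exact WithLp.ofLp_injective 1 (Unitization.ext h1 h2)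

/-- The involution of `A_p(G)¹`. -/
def star (x : ApUnit G p) : ApUnit G p :=
  mk (conj (WithLp.ofLp x).fst) (Ap.star (WithLp.ofLp x).snd)

theorem norm_star (x : ApUnit G p) : ‖star x‖ = ‖x‖ := by
  rw [star, norm_mk, Ap.norm_star, RCLike.norm_conj, norm_def]

theorem hat_star (x : ApUnit G p) (γ : PontryaginDual G) : hat (star x) γ = conj (hat x γ) := by
  rw [star, hat_mk, Ap.toL1_star, fourier_starL1, hat, map_add]

/-- An explicit inverse on the dual group, with control of the norm. -/
theorem exists_hat_mul_hat_eq_one [Infinite (PontryaginDual G)] (h2 : 2 ≤ p) {n : ℕ}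
    (hn : Odd n) (hpn : p ≤ 2 * n) {δ : ℝ} (hδ : 0 < δ) {x : ApUnit G p} (hx : ‖x‖ ≤ 1)
    (hxδ : ∀ γ, δ ≤ ‖hat x γ‖) {Δ : ℝ} (hΔ : Δ = δ ^ (2 * n) * (1 - (1 - δ ^ 2) ^ n)) :
    ∃ y : ApUnit G p, hat x * hat y = 1 ∧ ‖y‖ ≤ 1 / δ ^ (2 * n) + 2 * (1 - Δ) / Δ ^ 2 := by
  have hn0 : n ≠ 0 := hn.pos.ne'
  set l := (WithLp.ofLp x).fst with hl
  have hlδ : δ ≤ ‖l‖ := ge_of_tendsto' (tendsto_hat x).norm hxδ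
  have hl1 : ‖l‖ ≤ 1 := by
    rw [norm_def] at hx
    linarith [norm_nonneg (WithLp.ofLp x).snd]
  set a : ℝ := ‖l‖ ^ 2 with ha
  have hδa : δ ^ 2 ≤ a := pow_le_pow_left₀ hδ.le hlδ 2
  have ha1 : a ≤ 1 := pow_le_one₀ (norm_nonneg _) hl1
  have ha0 : 0 < a := (pow_pos hδ 2).trans_le hδa
  have han : 0 < a ^ n := pow_pos ha0 n
  have hδn : δ ^ (2 * n) ≤ a ^ n := by
    rw [pow_mul]
    exact pow_le_pow_left₀ (sq_nonneg δ) hδa n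
  have hq0 : 0 ≤ (1 - δ ^ 2) ^ n := pow_nonneg (by linarith) n
  have hq1 : (1 - δ ^ 2) ^ n < 1 := pow_lt_one₀ (by linarith) (by nlinarith) hn0
  have hδ0 : 0 < δ ^ (2 * n) := pow_pos hδ _
  have hΔ0 : 0 < Δ := hΔ ▸ mul_pos hδ0 (sub_pos.2 hq1)
  have hΔa : Δ ≤ a ^ n := by
    rw [hΔ]
    nlinarith
  -- the non-scalar part of `x* x`
  set h : Ap G p := (WithLp.ofLp (star x * x)).snd with hh
  have hfst : (WithLp.ofLp (star x * x)).fst = a := by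
    rw [WithLp.unitization_mul, Unitization.fst_mul, ← hl, ha, star, mk]
    simp [← hl, Complex.conj_mul']
  -- The `ℓ¹`-sum norm of the unitization gives `a + ‖h‖ = ‖x* x‖ ≤ 1`.
  have hhn : ‖h‖ ≤ 1 - a := by
    have h1 : ‖star x * x‖ ≤ 1 := by
      refine (norm_mul_le _ _).trans ?_
      rw [norm_star]
      nlinarith [norm_nonneg x]
    rw [norm_def, hfst, Complex.norm_real, Real.norm_of_nonneg ha0.le] at h1
    linarith
  set H := fourier (Ap.toL1 h) with hH
  have hsum : ∀ γ, conj (hat x γ) * hat x γ = a + H γ := fun γ => by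
    rw [← hat_star, ← hfst]
    exact congrFun (map_mul hatHom (star x) x).symm γ
  have hHt : ∀ γ, H γ = ((‖hat x γ‖ ^ 2 - a : ℝ) : ℂ) := fun γ => by
    have := hsum γ
    rw [Complex.conj_mul'] at this
    push_cast
    linear_combination -this
  have hlow : ∀ γ, Δ ≤ ‖(a : ℂ) ^ n + H γ ^ n‖ := fun γ => by
    rw [hHt, ← Complex.ofReal_pow, ← Complex.ofReal_pow, ← Complex.ofReal_add, Complex.norm_real]
    refine le_trans ?_ (le_abs_self _)
    rw [hΔ]
    exact le_pow_add_pow_of_odd hδa ha1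
      (sub_le_sub_right (pow_le_pow_left₀ hδ.le (hxδ γ) 2) a) hn
  -- the inverse of `aⁿ + hⁿ`
  let b : PontryaginDual G → ℂ := fun γ => -(H γ ^ n / ((a : ℂ) ^ n * ((a : ℂ) ^ n + H γ ^ n)))
  -- `K` is chosen so that `‖b γ‖ ≤ K ‖H γ‖ⁿ`.
  set K : ℝ := 1 / (a ^ n * Δ) with hK
  have hK0 : 0 ≤ K := by positivity
  have h1a : 0 ≤ 1 - a := sub_nonneg.2 ha1
  have hp0 : 0 < p := by linarith
  -- The hypothesis `p ≤ 2n` is used here: it puts `H` in `ℓ²ⁿ`, so `Hⁿ` lies in `ℓ²` with norm at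
  -- most `(1 - a)ⁿ`.
  obtain ⟨hHs, hHle⟩ := summable_rpow_of_le (fun γ => norm_nonneg (H γ)) hp0 hpn h1a
    (Ap.summable_fourier h)
    ((Ap.tsum_fourier_le h).trans (Real.rpow_le_rpow (norm_nonneg _) hhn hp0.le))
  have hpow : ∀ t : ℝ, t ^ (2 * n : ℝ) = (t ^ n) ^ 2 := fun t => by
    rw [← pow_mul, mul_comm n, ← Real.rpow_natCast]
    push_cast
    rfl
  simp only [hpow] at hHs hHle
  have hbH : ∀ γ, ‖b γ‖ ^ (2 : ℝ) ≤ K ^ 2 * (‖H γ‖ ^ n) ^ 2 := fun γ => by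
    rw [Real.rpow_two, ← mul_pow]
    refine pow_le_pow_left₀ (norm_nonneg _) ?_ 2
    simp only [b, norm_neg, norm_div, norm_mul, norm_pow, Complex.norm_real,
      Real.norm_of_nonneg ha0.le]
    rw [hK, one_div_mul_eq_div]
    gcongr
    exact hlow γ
  have hbs : Summable fun γ => ‖b γ‖ ^ (2 : ℝ) :=
    Summable.of_nonneg_of_le (fun γ => Real.rpow_nonneg (norm_nonneg _) _) hbH (hHs.mul_left _)
  have hbB : ∑' γ, ‖b γ‖ ^ (2 : ℝ) ≤ (K * (1 - a) ^ n) ^ (2 : ℝ) := by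
    refine (hbs.tsum_le_tsum hbH (hHs.mul_left _)).trans ?_
    rw [tsum_mul_left, Real.rpow_two, mul_pow]
    exact mul_le_mul_of_nonneg_left hHle (sq_nonneg K)
  obtain ⟨g, hg, hgn⟩ := Ap.exists_fourier_eq_of_summable_sq h2 hbs
    (mul_nonneg hK0 (pow_nonneg h1a n)) hbB
  -- the cofactor of `a + h` in `aⁿ + hⁿ`
  let S : ApUnit G p :=
    ∑ i ∈ Finset.range n, ((a : ℂ) ^ i) • (-mk 0 h) ^ (n - 1 - i)
  have hS : ‖S‖ ≤ 1 := by
    refine le_trans ?_ (geom_sum₂_le_one ha0.le (norm_nonneg h) (by linarith) hn0)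
    refine norm_sum_le_of_le _ fun i _ => ?_
    rw [norm_smul, norm_pow, Complex.norm_real, Real.norm_of_nonneg ha0.le]
    gcongr
    refine (norm_pow_le _ _).trans ?_
    rw [norm_neg, norm_mk, norm_zero, zero_add]
  -- The geometric sum telescopes to `aⁿ - (-H)ⁿ`, which is `aⁿ + Hⁿ` because `n` is odd.
  have hhatS : ∀ γ, hat S γ * (a + H γ) = (a : ℂ) ^ n + H γ ^ n := fun γ => by
    have h3 : hat S γ = ∑ i ∈ Finset.range n, (a : ℂ) ^ i * (-H γ) ^ (n - 1 - i) := by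
      rw [← hatHom_apply, map_sum, Finset.sum_apply]
      refine Finset.sum_congr rfl fun i _ => ?_
      rw [map_smul, map_pow, map_neg, hatHom_apply, Pi.smul_apply, Pi.pow_apply, Pi.neg_apply,
        hat_mk, zero_add, smul_eq_mul]
    rw [h3, ← sub_neg_eq_add, (Commute.all _ _).geom_sum₂_mul, hn.neg_pow, sub_neg_eq_add]
  -- Multiplying `x` by `x*` gives `a + h`, then by `S` gives `aⁿ + hⁿ`, and the last factor inverts
  -- this.
  refine ⟨star x * S * mk (((a : ℂ) ^ n)⁻¹) g, ?_, ?_⟩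
  · funext γ
    have hne : (a : ℂ) ^ n + H γ ^ n ≠ 0 := norm_pos_iff.1 (hΔ0.trans_le (hlow γ))
    have hne' : (a : ℂ) ^ n ≠ 0 := pow_ne_zero n (Complex.ofReal_ne_zero.2 ha0.ne')
    rw [← hatHom_apply (_ * _), map_mul, map_mul]
    simp only [Pi.mul_apply, hatHom_apply, hat_star, hat_mk, hg, Pi.one_apply, b]
    calc _ = (hat S γ * (conj (hat x γ) * hat x γ)) * (((a : ℂ) ^ n)⁻¹ +
          -(H γ ^ n / ((a : ℂ) ^ n * ((a : ℂ) ^ n + H γ ^ n)))) := by ring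
      _ = 1 := by
          rw [hsum, hhatS]
          field_simp
          ring
  · have h4 : ‖star x * S‖ ≤ 1 := by
      refine (norm_mul_le _ _).trans ?_
      rw [norm_star]
      exact mul_le_one₀ hx (norm_nonneg _) hS
    calc _ ≤ ‖star x * S‖ * ‖(mk (((a : ℂ) ^ n)⁻¹) g : ApUnit G p)‖ := norm_mul_le _ _
      _ ≤ ‖(mk (((a : ℂ) ^ n)⁻¹) g : ApUnit G p)‖ := mul_le_of_le_one_left (norm_nonneg _) h4
      _ = (a ^ n)⁻¹ + ‖g‖ := by
          rw [norm_mk, norm_inv, norm_pow, Complex.norm_real, Real.norm_of_nonneg ha0.le]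
      _ ≤ 1 / δ ^ (2 * n) + 2 * (1 - Δ) / Δ ^ 2 := by
          rw [one_div]
          refine add_le_add (inv_anti₀ hδ0 hδn) (hgn.trans ?_)
          -- Chain: `(1 - a)ⁿ ≤ 1 - a ≤ 1 - aⁿ ≤ 1 - Δ`.
          have h5 : (1 - a) ^ n ≤ 1 - Δ := by
            have h6 : (1 - a) ^ n ≤ 1 - a := pow_le_of_le_one h1a (by linarith) hn0
            have h7 : a ^ n ≤ a := pow_le_of_le_one ha0.le ha1 hn0
            linarith
          have h8 : K ≤ 1 / Δ ^ 2 := by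
            rw [hK, sq]
            gcongr
          calc 2 * (K * (1 - a) ^ n) ≤ 2 * (1 / Δ ^ 2 * (1 - Δ)) := by gcongr
            _ = 2 * (1 - Δ) / Δ ^ 2 := by ring

theorem isUnit_and_norm_inverse_le [Infinite (PontryaginDual G)] (h2 : 2 ≤ p) {n : ℕ}
    (hn : Odd n) (hpn : p ≤ 2 * n) {δ : ℝ} (hδ : 0 < δ) {x : ApUnit G p} (hx : ‖x‖ ≤ 1)
    (hxδ : ∀ γ, δ ≤ ‖hat x γ‖) {Δ : ℝ} (hΔ : Δ = δ ^ (2 * n) * (1 - (1 - δ ^ 2) ^ n)) :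
    IsUnit x ∧ ‖Ring.inverse x‖ ≤ 1 / δ ^ (2 * n) + 2 * (1 - Δ) / Δ ^ 2 := by
  obtain ⟨y, hxy, hy⟩ := exists_hat_mul_hat_eq_one h2 hn hpn hδ hx hxδ hΔ
  have h1 : x * y = 1 := hat_injective (by
    rw [← hatHom_apply, ← hatHom_apply, map_mul, map_one]
    exact hxy)
  have h3 : y * x = 1 := hat_injective (by
    rw [← hatHom_apply, ← hatHom_apply, map_mul, map_one, mul_comm]
    exact hxy)
  let u : (ApUnit G p)ˣ := ⟨x, y, h1, h3⟩
  refine ⟨u.isUnit, ?_⟩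
  rw [show Ring.inverse x = y from Ring.inverse_unit u]
  exact hy

end ApUnit

end

end FourierAlgebra

/-! ### The main theorem. -/

theorem mainTheorem1 {G : Type*} [CommGroup G] [TopologicalSpace G] [IsTopologicalGroup G]
    [CompactSpace G] [T2Space G] [MeasurableSpace G] [BorelSpace G]
    (hG : ¬ DiscreteTopology G) (p : ℝ) [Fact (1 ≤ p)] (hp : 2 < p)
    (n : ℕ) (hn : IsLeast {m : ℕ | Odd m ∧ p / m ≤ 2} n) :
    (∀ (δ : ℝ), 0 < δ → ∀ (l : ℂ) (f : FourierAlgebra.Ap G p) (x : FourierAlgebra.ApUnit G p),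
      x = FourierAlgebra.ApUnit.mk l f → ‖x‖ ≤ 1 →
      (∀ γ : PontryaginDual G, δ ≤ ‖FourierAlgebra.ApUnit.hat x γ‖) →
      ∀ Δ : ℝ, Δ = δ ^ (2 * n) * (1 - (1 - δ ^ 2) ^ n) →
      IsUnit x ∧ ‖Ring.inverse x‖ ≤ 1 / δ ^ (2 * n) + 2 * (1 - Δ) / Δ ^ 2) ∧
    (∀ δ : ℝ, 0 < δ → FourierAlgebra.inversionConstant G p δ < ⊤) := by
  have hinf : Infinite (PontryaginDual G) := FourierAlgebra.infinite_pontryaginDual hG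
  obtain ⟨hodd, hpn⟩ := hn.1
  have hpn' : p ≤ 2 * n := (div_le_iff₀ (Nat.cast_pos.2 hodd.pos)).1 hpn
  refine ⟨fun δ hδ l f x _ hx hxδ Δ hΔ =>
    FourierAlgebra.ApUnit.isUnit_and_norm_inverse_le hp.le hodd hpn' hδ hx hxδ hΔ,
    fun δ hδ => ?_⟩
  -- The bound depends only on `δ` and `n`, so it dominates the whole supremum.
  refine lt_of_le_of_lt (iSup_le fun u => iSup₂_le fun hu huδ => ?_)
    (ENNReal.ofReal_lt_top (r := 1 / δ ^ (2 * n) +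
      2 * (1 - δ ^ (2 * n) * (1 - (1 - δ ^ 2) ^ n)) / (δ ^ (2 * n) * (1 - (1 - δ ^ 2) ^ n)) ^ 2))
  rw [← Ring.inverse_unit u]
  exact ENNReal.ofReal_le_ofReal
    (FourierAlgebra.ApUnit.isUnit_and_norm_inverse_le hp.le hodd hpn' hδ hu huδ rfl).2
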